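/- All vector spaces are real. A Banach lattice is a Riesz space that is complete in a norm with $\|x\|\le\|y\|$ whenever $|x|\le|y|$. A Banach sequence lattice is a linear space $Y\subseteq\mathbb{R}^{\mathbb{N}}$ containing all canonical sequences $e_k$, with a complete norm $\|\cdot\|_Y$, such that if $f\in\mathbb{R}^{\mathbb{N}}$, $g\in Y$ and $|f|\le|g|$ coordinatewise, then $f\in Y$ and $\|f\|_Y\le\|g\|_Y$. For $t\in\mathbb{R}^n$ write $\|(t_1,\dots,t_n)\|_Y:=\|(t_1,\dots,t_n,0,0,\dots)\|_Y$. Let $\mathcal{H}_n$ be the space of continuous functions $h:\mathbb{R}^n\to\mathbb{R}$ with $h(\lambda t)=\lambda h(t)$ for all $\lambda\ge0$, with its pointwise order, and let $\pi_{n,j}(t)=t_j$. For a Banach lattice $X$ and $x=(x_1,\dots,x_n)\in X^n$, let $\tau_{n,x}:\mathcal{H}_n\to X$ be Krivine's functional calculus, i.e. the unique linear map with $\tau_{n,x}(\pi_{n,j})=x_j$ for $1\le j\le n$ and $\tau_{n,x}(h_1\vee h_2)=\tau_{n,x}(h_1)\vee\tau_{n,x}(h_2)$ for all $h_1,h_2\in\mathcal{H}_n$.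 Put $\|(x_1,\dots,x_n)\|_Y:=\tau_{n,x}\big(t\mapsto\|(t_1,\dots,t_n)\|_Y\big)\in X$. For a Banach space $E$, a linear operator $T:E\to X$ is $Y$-convex if there is a constant $C>0$ with $$\big\|\,\|(Tw_1,\dots,Tw_n)\|_Y\,\big\|_X\le C\,\big\|(\|w_1\|_E,\dots,\|w_n\|_E)\big\|_Y\qquad\text{for all } n\in\mathbb{N},\ w_1,\dots,w_n\in E,$$ and $\mathcal{K}^Y(E,X)$ denotes the set of all $Y$-convex operators $E\to X$. **Proposition.** Let $E$ be a Banach space, $X$ a Banach lattice and $Y$ a Banach sequence lattice. Then every finite rank operator $T:E\to X$ (a continuous linear operator whose image has finite dimension) is $Y$-convex. Hence, if $E\ne\{0\}$ and $X\ne\{0\}$, the space $\mathcal{K}^Y(E,X)$ contains a nonzero operator. -/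

import Mathlib

open Filter Topology

/-! ### Banach sequence lattices -/

/-- A Banach sequence lattice: an ideal `carrier` of the space of all real sequences (that is,
measurable functions for the counting measure on `ℕ`), with a complete norm `norm` that is
order-preserving, containing all the canonical sequences `eₖ`. -/
structure BanachSeqLattice where
  /-- the sequences that belong to the space -/
  carrier : Submodule ℝ (ℕ → ℝ)
  /-- the norm of the space -/
  norm : Seminorm ℝ carrier
  eq_zero_of_norm_eq_zero : ∀ y : carrier, norm y = 0 → y = 0
  mem_of_abs_le : ∀ f : ℕ → ℝ, ∀ g ∈ carrier, (∀ k, |f k| ≤ |g k|) → f ∈ carrier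
  norm_le_of_abs_le : ∀ f g : carrier,
    (∀ k, |(f : ℕ → ℝ) k| ≤ |(g : ℕ → ℝ) k|) → norm f ≤ norm g
  complete : ∀ u : ℕ → carrier,
    (∀ ε : ℝ, 0 < ε → ∃ N : ℕ, ∀ p ≥ N, ∀ q ≥ N, norm (u p - u q) < ε) →
      ∃ y : carrier, Tendsto (fun p => norm (u p - y)) atTop (𝓝 0)
  single_mem : ∀ k : ℕ, (Pi.single k 1 : ℕ → ℝ) ∈ carrier

/-- The sequence `(t₁, …, tₙ, 0, 0, …)`. -/
def extendZero (n : ℕ) : (Fin n → ℝ) →ₗ[ℝ] (ℕ → ℝ) where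
  toFun t k := if h : k < n then t ⟨k, h⟩ else 0
  map_add' s t := by
    funext k
    by_cases h : k < n <;> simp [h]
  map_smul' c t := by
    funext k
    by_cases h : k < n <;> simp [h]

namespace BanachSeqLattice

theorem extendZero_mem (Y : BanachSeqLattice) (n : ℕ) (t : Fin n → ℝ) :
    extendZero n t ∈ Y.carrier := by
  have h : extendZero n t = ∑ i : Fin n, t i • (Pi.single (i : ℕ) 1 : ℕ → ℝ) := by
    funext k
    rw [Finset.sum_apply]
    by_cases hk : k < n
    · rw [Finset.sum_eq_single (⟨k, hk⟩ : Fin n)]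
      · simp [extendZero, hk]
      · intro j _ hj
        have : k ≠ (j : ℕ) := fun e => hj (Fin.ext e.symm)
        simp [this]
      · simp
    · rw [Finset.sum_eq_zero]
      · simp [extendZero, hk]
      · intro j _
        have : k ≠ (j : ℕ) := fun e => hk (e ▸ j.2)
        simp [this]
  rw [h]
  exact Submodule.sum_mem _ fun i _ => Submodule.smul_mem _ _ (Y.single_mem _)

/-- The norm of `Y` restricted to `ℝⁿ`: `(t₁, …, tₙ) ↦ ‖(t₁, …, tₙ, 0, 0, …)‖_Y`. -/
def finNorm (Y : BanachSeqLattice) (n : ℕ) : Seminorm ℝ (Fin n → ℝ) :=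
  Y.norm.comp ((extendZero n).codRestrict Y.carrier (Y.extendZero_mem n))

theorem continuous_finNorm (Y : BanachSeqLattice) (n : ℕ) : Continuous (Y.finNorm n) := by
  have hb : ∀ t : Fin n → ℝ,
      Y.finNorm n t ≤ (∑ i, Y.finNorm n (Pi.single i 1)) * ‖t‖ := by
    intro t
    have ht : t = ∑ i, t i • (Pi.single i 1 : Fin n → ℝ) := by
      simpa using (pi_eq_sum_univ' t)
    calc Y.finNorm n t = Y.finNorm n (∑ i, t i • (Pi.single i 1 : Fin n → ℝ)) := by rw [← ht]
      _ ≤ ∑ i, Y.finNorm n (t i • (Pi.single i 1 : Fin n → ℝ)) :=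
        Finset.le_sum_of_subadditive _ (map_zero (Y.finNorm n)).le (map_add_le_add _) _ _
      _ ≤ ∑ i, Y.finNorm n (Pi.single i 1) * ‖t‖ := by
        refine Finset.sum_le_sum fun i _ => ?_
        rw [map_smul_eq_mul, mul_comm]
        exact mul_le_mul_of_nonneg_left (norm_le_pi_norm t i) (apply_nonneg _ _)
      _ = _ := by rw [Finset.sum_mul]
  refine (LipschitzWith.of_dist_le_mul (K := ⟨∑ i, Y.finNorm n (Pi.single i 1),
    Finset.sum_nonneg fun i _ => apply_nonneg _ _⟩) fun s t => ?_).continuous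
  rw [Real.dist_eq, dist_eq_norm]
  exact (abs_sub_map_le_sub _ s t).trans (hb (s - t))

end BanachSeqLattice

/-! ### Finite suprema of linear combinations in a vector lattice -/

section VectorLattice

set_option linter.unusedSectionVars false

variable {V W : Type*} [Lattice V] [AddCommGroup V] [IsOrderedAddMonoid V] [Module ℝ V]
  [IsOrderedModule ℝ V] [Lattice W] [AddCommGroup W] [IsOrderedAddMonoid W] [Module ℝ W]
  [IsOrderedModule ℝ W] {n : ℕ}

/-- `⋁ a ∈ A, ∑ i, aᵢ vᵢ` -/
def supLin (v : Fin n → V) (A : Finset (Fin n → ℝ)) (hA : A.Nonempty) : V :=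
  A.sup' hA (Fintype.linearCombination ℝ v)

theorem smul_sup_of_nonneg {c : ℝ} (hc : 0 ≤ c) (a b : V) : c • (a ⊔ b) = c • a ⊔ c • b := by
  rcases hc.eq_or_lt with rfl | hc
  · simp
  · apply le_antisymm
    · rw [← le_inv_smul_iff_of_pos hc]
      refine sup_le ?_ ?_ <;> rw [le_inv_smul_iff_of_pos hc]
      exacts [le_sup_left, le_sup_right]
    · exact sup_le (smul_le_smul_of_nonneg_left le_sup_left hc.le)
        (smul_le_smul_of_nonneg_left le_sup_right hc.le)

theorem map_supLin (φ : V →ₗ[ℝ] W) (hφ : ∀ a b, φ (a ⊔ b) = φ a ⊔ φ b) (v : Fin n → V)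
    (A : Finset (Fin n → ℝ)) (hA : A.Nonempty) :
    φ (supLin v A hA) = supLin (fun i => φ (v i)) A hA := by
  unfold supLin
  rw [Finset.apply_sup'_eq_sup'_comp hA φ hφ]
  congr 1
  funext a
  simp [Fintype.linearCombination_apply]

open scoped Classical Pointwise in
theorem supLin_add (v : Fin n → V) (A B : Finset (Fin n → ℝ)) (hA : A.Nonempty)
    (hB : B.Nonempty) :
    supLin v (A + B) (hA.add hB) = supLin v A hA + supLin v B hB := by
  unfold supLin
  apply le_antisymm
  · refine Finset.sup'_le _ _ fun c hc => ?_
    obtain ⟨a, ha, b, hb, rfl⟩ := Finset.mem_add.1 hc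
    rw [map_add]
    exact add_le_add (Finset.le_sup' _ ha) (Finset.le_sup' _ hb)
  · rw [← le_sub_iff_add_le]
    refine Finset.sup'_le _ _ fun a ha => ?_
    rw [le_sub_iff_add_le, ← le_sub_iff_add_le']
    refine Finset.sup'_le _ _ fun b hb => ?_
    rw [le_sub_iff_add_le', ← map_add]
    exact Finset.le_sup' (Fintype.linearCombination ℝ v) (Finset.add_mem_add ha hb)

open scoped Classical in
theorem supLin_union (v : Fin n → V) (A B : Finset (Fin n → ℝ)) (hA : A.Nonempty)
    (hB : B.Nonempty) :
    supLin v (A ∪ B) (hA.mono Finset.subset_union_left) = supLin v A hA ⊔ supLin v B hB :=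
  Finset.sup'_union hA hB _

open scoped Classical in
theorem supLin_smul (v : Fin n → V) (A : Finset (Fin n → ℝ)) (hA : A.Nonempty) {c : ℝ}
    (hc : 0 ≤ c) :
    supLin v (A.image (c • ·)) (hA.image _) = c • supLin v A hA := by
  unfold supLin
  rw [Finset.sup'_image, Finset.apply_sup'_eq_sup'_comp hA (c • ·) (smul_sup_of_nonneg hc)]
  congr 1
  funext a
  simp

/-- The vector sublattice generated by `v₁, …, vₙ`, as the set of all differences of finite suprema
of linear combinations. -/
def latSpan (v : Fin n → V) : Submodule ℝ V where
  carrier := {x | ∃ A, ∃ hA : A.Nonempty, ∃ B, ∃ hB : B.Nonempty,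
    x = supLin v A hA - supLin v B hB}
  zero_mem' := ⟨{0}, by simp, {0}, by simp, by simp⟩
  add_mem' := by
    classical
    rintro _ _ ⟨A, hA, B, hB, rfl⟩ ⟨C, hC, D, hD, rfl⟩
    exact ⟨_, hA.add hC, _, hB.add hD, by
      rw [supLin_add v A C hA hC, supLin_add v B D hB hD]; abel⟩
  smul_mem' := by
    classical
    rintro c _ ⟨A, hA, B, hB, rfl⟩
    rcases le_total 0 c with hc | hc
    · exact ⟨_, hA.image _, _, hB.image _, by
        rw [supLin_smul v A hA hc, supLin_smul v B hB hc, smul_sub]⟩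
    · exact ⟨_, hB.image _, _, hA.image _, by
        rw [supLin_smul v A hA (neg_nonneg.2 hc), supLin_smul v B hB (neg_nonneg.2 hc),
          neg_smul, neg_smul, smul_sub]; abel⟩

open scoped Pointwise in
theorem latSpan_sup (v : Fin n → V) {x y : V} (hx : x ∈ latSpan v) (hy : y ∈ latSpan v) :
    x ⊔ y ∈ latSpan v := by
  classical
  obtain ⟨A, hA, B, hB, rfl⟩ := hx
  obtain ⟨C, hC, D, hD, rfl⟩ := hy
  refine ⟨(A + D) ∪ (C + B), (hA.add hD).mono Finset.subset_union_left, B + D, hB.add hD, ?_⟩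
  rw [supLin_union v _ _ (hA.add hD) (hC.add hB), supLin_add v A D hA hD,
    supLin_add v C B hC hB, supLin_add v B D hB hD, sup_sub]
  congr 1 <;> abel

theorem latSpan_inf (v : Fin n → V) {x y : V} (hx : x ∈ latSpan v) (hy : y ∈ latSpan v) :
    x ⊓ y ∈ latSpan v := by
  have := Submodule.neg_mem _ (latSpan_sup v (Submodule.neg_mem _ hx) (Submodule.neg_mem _ hy))
  rwa [neg_sup, neg_neg, neg_neg] at this

theorem gen_mem_latSpan (v : Fin n → V) (i : Fin n) : v i ∈ latSpan v :=
  ⟨{Pi.single i 1}, by simp, {0}, by simp, by simp [supLin]⟩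

theorem map_mem_latSpan (φ : V →ₗ[ℝ] W) (hφ : ∀ a b, φ (a ⊔ b) = φ a ⊔ φ b) (v : Fin n → V)
    {x : V} (hx : x ∈ latSpan v) : φ x ∈ latSpan (fun i => φ (v i)) := by
  obtain ⟨A, hA, B, hB, rfl⟩ := hx
  exact ⟨A, hA, B, hB, by rw [map_sub, map_supLin φ hφ, map_supLin φ hφ]⟩

theorem exists_map_eq_of_mem_latSpan (φ : V →ₗ[ℝ] W) (hφ : ∀ a b, φ (a ⊔ b) = φ a ⊔ φ b)
    (v : Fin n → V) {y : W} (hy : y ∈ latSpan (fun i => φ (v i))) :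
    ∃ x ∈ latSpan v, φ x = y := by
  obtain ⟨A, hA, B, hB, rfl⟩ := hy
  exact ⟨_, ⟨A, hA, B, hB, rfl⟩, by rw [map_sub, map_supLin φ hφ, map_supLin φ hφ]⟩

theorem eq_on_latSpan (φ ψ : V →ₗ[ℝ] W) (hφ : ∀ a b, φ (a ⊔ b) = φ a ⊔ φ b)
    (hψ : ∀ a b, ψ (a ⊔ b) = ψ a ⊔ ψ b) (v : Fin n → V) (h : ∀ i, φ (v i) = ψ (v i))
    {x : V} (hx : x ∈ latSpan v) : φ x = ψ x := by
  obtain ⟨A, hA, B, hB, rfl⟩ := hx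
  simp only [map_sub, map_supLin φ hφ, map_supLin ψ hψ, h]

theorem sum_abs_mem_latSpan (v : Fin n → V) : ∑ i, |v i| ∈ latSpan v :=
  Submodule.sum_mem _ fun i _ =>
    latSpan_sup v (gen_mem_latSpan v i) (Submodule.neg_mem _ (gen_mem_latSpan v i))

/-- The unit sphere of the norm `∑ i, |tᵢ|` of `ℝⁿ` -/
def simplexSphere (n : ℕ) : Set (Fin n → ℝ) := {t | ∑ i, |t i| = 1}

instance (n : ℕ) : CompactSpace (simplexSphere n) := by
  rw [← isCompact_iff_compactSpace]
  refine Metric.isCompact_of_isClosed_isBounded ?_ ?_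
  · exact isClosed_eq (by fun_prop) continuous_const
  · refine (Metric.isBounded_closedBall (x := (0 : Fin n → ℝ)) (r := 1)).subset fun t ht => ?_
    rw [mem_closedBall_zero_iff, pi_norm_le_iff_of_nonneg zero_le_one]
    intro i
    rw [← show ∑ i, |t i| = 1 from ht]
    exact Finset.single_le_sum (f := fun i => |t i|) (fun i _ => abs_nonneg _)
      (Finset.mem_univ i)

theorem supLin_le_supLin (v : Fin n → V) (A B : Finset (Fin n → ℝ)) (hA : A.Nonempty)
    (hB : B.Nonempty) (h : ∀ t ∈ simplexSphere n, supLin t A hA ≤ supLin t B hB) :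
    supLin v A hA ≤ supLin v B hB := by
  refine Finset.sup'_le _ _ fun a ha => ?_
  have hconv : Convex ℝ {c : Fin n → ℝ | Fintype.linearCombination ℝ v c ≤ supLin v B hB} :=
    (convex_Iic (supLin v B hB)).linear_preimage (Fintype.linearCombination ℝ v)
  have hsub : convexHull ℝ (B : Set (Fin n → ℝ)) ⊆
      {c : Fin n → ℝ | Fintype.linearCombination ℝ v c ≤ supLin v B hB} :=
    convexHull_min (fun b hb => Finset.le_sup' (Fintype.linearCombination ℝ v) hb) hconv
  refine hsub ?_
  by_contra hna
  obtain ⟨f, u, hfB, hfa⟩ := geometric_hahn_banach_closed_point (convex_convexHull ℝ _)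
    (B.finite_toSet.isClosed_convexHull (𝕜 := ℝ)) hna
  have hf : ∀ c : Fin n → ℝ,
      f c = Fintype.linearCombination ℝ (fun i => f (Pi.single i 1)) c := by
    intro c
    conv_lhs => rw [show c = ∑ i, c i • (Pi.single i 1 : Fin n → ℝ) by
      simpa using (pi_eq_sum_univ' c)]
    simp [Fintype.linearCombination_apply]
  have hlt : ∀ b ∈ B, f b < f a := fun b hb => (hfB b (subset_convexHull ℝ _ hb)).trans hfa
  set r : ℝ := ∑ i, |f (Pi.single i 1)| with hr
  have hr0 : 0 < r := by
    refine (Finset.sum_nonneg fun i _ => abs_nonneg _).lt_of_ne fun h0 => ?_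
    have hz : ∀ i, f (Pi.single i 1) = 0 := fun i => by
      have := (Finset.sum_eq_zero_iff_of_nonneg fun i _ => abs_nonneg _).1 h0.symm i
        (Finset.mem_univ i)
      simpa using this
    obtain ⟨b, hb⟩ := hB
    have := hlt b hb
    have hz2 : ∀ c, f c = 0 := fun c => by
      rw [hf c]
      simp [hz, Fintype.linearCombination_apply]
    rw [hz2, hz2] at this
    exact lt_irrefl _ this
  have hscale : ∀ c : Fin n → ℝ, Fintype.linearCombination ℝ
      (fun i => r⁻¹ * f (Pi.single i 1)) c = r⁻¹ * f c := by
    intro c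
    rw [hf c]
    simp only [Fintype.linearCombination_apply, smul_eq_mul, Finset.mul_sum]
    exact Finset.sum_congr rfl fun i _ => by ring
  have hS : (fun i => r⁻¹ * f (Pi.single i 1)) ∈ simplexSphere n := by
    change ∑ i, |r⁻¹ * f (Pi.single i 1)| = 1
    simp only [abs_mul, ← Finset.mul_sum, abs_of_pos (inv_pos.2 hr0), ← hr]
    exact inv_mul_cancel₀ hr0.ne'
  have h1 := (Finset.le_sup' (Fintype.linearCombination ℝ
    (fun i => r⁻¹ * f (Pi.single i 1))) ha).trans (h _ hS)
  obtain ⟨b, hb, hbe⟩ := Finset.exists_mem_eq_sup' hB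
    (Fintype.linearCombination ℝ (fun i => r⁻¹ * f (Pi.single i 1)))
  rw [supLin, hbe, hscale, hscale] at h1
  exact absurd (le_of_mul_le_mul_left h1 (inv_pos.2 hr0)) (not_le.2 (hlt b hb))

end VectorLattice

/-! ### Krivine's functional calculus -/

/-- The space of continuous functions `h : ℝⁿ → ℝ` that are homogeneous of degree one,
`h (c t) = c h(t)` for `c ≥ 0`. -/
def HomogFun (n : ℕ) : Submodule ℝ C(Fin n → ℝ, ℝ) where
  carrier := {h | ∀ c : ℝ, 0 ≤ c → ∀ t, h (c • t) = c * h t}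
  zero_mem' := by simp
  add_mem' := by
    intro f g hf hg c hc t
    simp [hf c hc t, hg c hc t, mul_add]
  smul_mem' := by
    intro a f hf c hc t
    simp [hf c hc t, mul_left_comm]

/-- The pointwise lattice operations of `HomogFun n` -/
instance (n : ℕ) : Lattice (HomogFun n) :=
  Subtype.lattice
    (fun {f g} hf hg c hc t => by
      simp [hf c hc t, hg c hc t, mul_max_of_nonneg _ _ hc])
    (fun {f g} hf hg c hc t => by
      simp [hf c hc t, hg c hc t, mul_min_of_nonneg _ _ hc])

/-- The `j`-th projection, as an element of `HomogFun n` -/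
def proj (n : ℕ) (j : Fin n) : HomogFun n :=
  ⟨⟨fun t => t j, continuous_apply j⟩, fun c _ t => by simp⟩

/-- The norm of `Y` on `ℝⁿ`, as an element of `HomogFun n` -/
def BanachSeqLattice.homogNorm (Y : BanachSeqLattice) (n : ℕ) : HomogFun n :=
  ⟨⟨Y.finNorm n, Y.continuous_finNorm n⟩, fun c hc t => by
    simp [map_smul_eq_mul, abs_of_nonneg hc]⟩

section Krivine

variable {n : ℕ} {X : Type*} [NormedAddCommGroup X] [Lattice X] [HasSolidNorm X]
  [IsOrderedAddMonoid X] [NormedSpace ℝ X] [IsOrderedModule ℝ X]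

instance : IsOrderedAddMonoid (HomogFun n) where
  add_le_add_left f g h k t := by exact add_le_add_left (α := ℝ) (h t) _

instance : IsOrderedModule ℝ (HomogFun n) where
  smul_le_smul_of_nonneg_left c hc f g h t :=
    mul_le_mul_of_nonneg_left (a := c) (b := f.1 t) (c := g.1 t) (h t) hc
  smul_le_smul_of_nonneg_right f hf c d h t :=
    mul_le_mul_of_nonneg_right (a := f.1 t) (b := c) (c := d) h (hf t)

/-- `τ` is Krivine's functional calculus at `(x₁, …, xₙ)`: it sends the `j`-th projection to `xⱼ`
and preserves suprema. -/
def IsKrivine (x : Fin n → X) (τ : HomogFun n →ₗ[ℝ] X) : Prop :=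
  (∀ j, τ (proj n j) = x j) ∧ ∀ h₁ h₂ : HomogFun n, τ (h₁ ⊔ h₂) = τ h₁ ⊔ τ h₂

set_option linter.unusedSectionVars false

/-- Restriction of a homogeneous function to the sphere -/
def restr (n : ℕ) : HomogFun n →ₗ[ℝ] C(simplexSphere n, ℝ) where
  toFun h := h.1.restrict _
  map_add' _ _ := rfl
  map_smul' _ _ := rfl

theorem restr_sup (h₁ h₂ : HomogFun n) : restr n (h₁ ⊔ h₂) = restr n h₁ ⊔ restr n h₂ := rfl

theorem sum_abs_restr_proj : ∑ j, |restr n (proj n j)| = 1 := by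
  ext t
  have := t.2
  simp only [ContinuousMap.sum_apply, ContinuousMap.one_apply]
  exact this

theorem mem_closure_latSpan_restr (f : C(simplexSphere n, ℝ)) :
    f ∈ closure (latSpan (fun j => restr n (proj n j)) : Set C(simplexSphere n, ℝ)) := by
  have h1 : (1 : C(simplexSphere n, ℝ)) ∈ latSpan (fun j => restr n (proj n j)) := by
    rw [← sum_abs_restr_proj]
    exact sum_abs_mem_latSpan _
  rw [ContinuousMap.sublattice_closure_eq_top _ ⟨1, h1⟩ (fun f hf g hg => latSpan_inf _ hf hg)
    (fun f hf g hg => latSpan_sup _ hf hg)]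
  · trivial
  intro v s t
  by_cases hst : s = t
  · subst hst
    exact ⟨v s • 1, Submodule.smul_mem _ _ h1, by simp, by simp⟩
  · obtain ⟨j, hj⟩ : ∃ j, s.1 j ≠ t.1 j := by
      by_contra! h
      exact hst (Subtype.ext (funext h))
    have hj2 : t.1 j - s.1 j ≠ 0 := sub_ne_zero.2 hj.symm
    refine ⟨v s • 1 + ((v t - v s) / (t.1 j - s.1 j)) • (restr n (proj n j) - s.1 j • 1),
      Submodule.add_mem _ (Submodule.smul_mem _ _ h1) (Submodule.smul_mem _ _
        (Submodule.sub_mem _ (gen_mem_latSpan (fun j => restr n (proj n j)) j)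
          (Submodule.smul_mem _ _ h1))), ?_, ?_⟩
    · change v s * 1 + (v t - v s) / (t.1 j - s.1 j) * (s.1 j - s.1 j * 1) = v s
      ring
    · change v s * 1 + (v t - v s) / (t.1 j - s.1 j) * (t.1 j - s.1 j * 1) = v t
      field_simp
      ring

/-- The pairs `(πⱼ, xⱼ)` -/
def graphGen (x : Fin n → X) (j : Fin n) : C(simplexSphere n, ℝ) × X := (restr n (proj n j), x j)

instance : IsOrderedModule ℝ (C(simplexSphere n, ℝ) × X) where
  smul_le_smul_of_nonneg_left c hc f g h :=
    ⟨fun t => mul_le_mul_of_nonneg_left (a := c) (b := f.1 t) (c := g.1 t) (h.1 t) hc,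
      smul_le_smul_of_nonneg_left h.2 hc⟩
  smul_le_smul_of_nonneg_right f hf c d h :=
    ⟨fun t => mul_le_mul_of_nonneg_right (a := f.1 t) (b := c) (c := d) h (hf.1 t),
      smul_le_smul_of_nonneg_right h hf.2⟩

theorem continuous_sup_prod :
    Continuous fun p : (C(simplexSphere n, ℝ) × X) × (C(simplexSphere n, ℝ) × X) => p.1 ⊔ p.2 := by
  have : HasSolidNorm C(simplexSphere n, ℝ) := ⟨fun f g h => by
    rw [ContinuousMap.norm_le f (norm_nonneg g)]
    exact fun t => (h t).trans (g.norm_coe_le_norm t)⟩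
  exact ((continuous_fst.comp continuous_fst).sup (continuous_fst.comp continuous_snd)).prodMk
    ((continuous_snd.comp continuous_fst).sup (continuous_snd.comp continuous_snd))

theorem snd_nonpos_of_mem_latSpan (x : Fin n → X) {p : C(simplexSphere n, ℝ) × X}
    (hp : p ∈ latSpan (graphGen x)) (h : p.1 ≤ 0) : p.2 ≤ 0 := by
  obtain ⟨A, hA, B, hB, rfl⟩ := hp
  have h2 : ∀ C : Finset (Fin n → ℝ), ∀ hC : C.Nonempty,
      (supLin (graphGen x) C hC).2 = supLin x C hC := fun C hC =>
    map_supLin (LinearMap.snd ℝ C(simplexSphere n, ℝ) X) (fun _ _ => rfl) (graphGen x) C hC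
  have h1 : ∀ C : Finset (Fin n → ℝ), ∀ hC : C.Nonempty, ∀ t : simplexSphere n,
      (supLin (graphGen x) C hC).1 t = supLin t.1 C hC := fun C hC t =>
    map_supLin ((ContinuousMap.evalCLM ℝ t).toLinearMap.comp
      (LinearMap.fst ℝ C(simplexSphere n, ℝ) X)) (fun _ _ => rfl) (graphGen x) C hC
  rw [Prod.snd_sub, sub_nonpos, h2, h2]
  refine supLin_le_supLin x A B hA hB fun t ht => ?_
  have h3 : (supLin (graphGen x) A hA).1 ⟨t, ht⟩ - (supLin (graphGen x) B hB).1 ⟨t, ht⟩ ≤ 0 :=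
    h ⟨t, ht⟩
  rw [h1, h1] at h3
  exact sub_nonpos.1 h3

theorem norm_snd_le_of_mem_latSpan (x : Fin n → X) {p : C(simplexSphere n, ℝ) × X}
    (hp : p ∈ latSpan (graphGen x)) : ‖p.2‖ ≤ ‖p.1‖ * ‖∑ j, |x j|‖ := by
  have key : ∀ q ∈ latSpan (graphGen x), q.2 ≤ ‖q.1‖ • ∑ j, |x j| := by
    intro q hq
    have hE := sum_abs_mem_latSpan (graphGen x)
    have hE1 : (∑ j, |graphGen x j|).1 = 1 := by
      rw [Prod.fst_sum]
      exact sum_abs_restr_proj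
    have hE2 : (∑ j, |graphGen x j|).2 = ∑ j, |x j| := by
      rw [Prod.snd_sum]
      rfl
    have := snd_nonpos_of_mem_latSpan x (Submodule.sub_mem _ hq (Submodule.smul_mem _ ‖q.1‖ hE)) (by
      rw [Prod.fst_sub, Prod.smul_fst, hE1, sub_nonpos]
      intro t
      simpa using (le_abs_self _).trans (q.1.norm_coe_le_norm t))
    rwa [Prod.snd_sub, Prod.smul_snd, hE2, sub_nonpos] at this
  have h1 := key p hp
  have h2 := key (-p) (Submodule.neg_mem _ hp)
  rw [Prod.fst_neg, norm_neg, Prod.snd_neg] at h2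
  have h3 : |p.2| ≤ |(‖p.1‖ • ∑ j, |x j| : X)| := (sup_le h1 h2).trans (le_abs_self _)
  have h4 := norm_le_norm_of_abs_le_abs h3
  rwa [norm_smul, norm_norm] at h4

theorem exists_isKrivine [CompleteSpace X] (x : Fin n → X) :
    ∃ τ : HomogFun n →ₗ[ℝ] X, IsKrivine x τ := by
  set Γ : Submodule ℝ (C(simplexSphere n, ℝ) × X) := (latSpan (graphGen x)).topologicalClosure
    with hΓ
  have hcoe : (Γ : Set (C(simplexSphere n, ℝ) × X)) = closure (latSpan (graphGen x)) :=
    Submodule.topologicalClosure_coe _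
  have hbd : ∀ p ∈ Γ, ‖p.2‖ ≤ ‖p.1‖ * ‖∑ j, |x j|‖ := by
    have : closure (latSpan (graphGen x) : Set (C(simplexSphere n, ℝ) × X)) ⊆
        {p | ‖p.2‖ ≤ ‖p.1‖ * ‖∑ j, |x j|‖} :=
      closure_minimal (fun p hp => norm_snd_le_of_mem_latSpan x hp)
        (isClosed_le (by fun_prop) (by fun_prop))
    intro p hp
    exact this (hcoe ▸ hp)
  have hsup : ∀ p ∈ Γ, ∀ q ∈ Γ, p ⊔ q ∈ Γ := by
    intro p hp q hq
    have hp2 : p ∈ closure (latSpan (graphGen x) : Set (C(simplexSphere n, ℝ) × X)) := hcoe ▸ hp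
    have hq2 : q ∈ closure (latSpan (graphGen x) : Set (C(simplexSphere n, ℝ) × X)) := hcoe ▸ hq
    have := map_mem_closure₂ (f := fun a b => a ⊔ b) continuous_sup_prod hp2 hq2
      (u := (latSpan (graphGen x) : Set (C(simplexSphere n, ℝ) × X)))
      fun a ha b hb => latSpan_sup _ ha hb
    rw [← hcoe] at this
    exact this
  have hcomplete : CompleteSpace Γ :=
    (Submodule.isClosed_topologicalClosure (latSpan (graphGen x))).completeSpace_coe
  let F : Γ →L[ℝ] C(simplexSphere n, ℝ) := (ContinuousLinearMap.fst ℝ _ X).comp Γ.subtypeL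
  have hanti : AntilipschitzWith (max 1 ‖∑ j, |x j|‖₊) F := by
    refine F.antilipschitz_of_bound fun p => ?_
    have h1 := hbd p.1 p.2
    change ‖p.1‖ ≤ (max 1 ‖∑ j, |x j|‖₊ : NNReal) * ‖p.1.1‖
    rw [Prod.norm_def, NNReal.coe_max, NNReal.coe_one, coe_nnnorm]
    have h0 := norm_nonneg p.1.1
    refine max_le ?_ (h1.trans ?_)
    · exact le_mul_of_one_le_left h0 (le_max_left _ _)
    · rw [mul_comm]
      exact mul_le_mul_of_nonneg_right (le_max_right _ _) h0
  have hclosed : IsClosed (Set.range F) := hanti.isClosed_range F.uniformContinuous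
  have hsurj : Function.Surjective F := by
    intro f
    have hf := mem_closure_latSpan_restr f
    refine hclosed.closure_subset_iff.2 ?_ hf
    intro g hg
    obtain ⟨p, hp, hpg⟩ := exists_map_eq_of_mem_latSpan
      (LinearMap.fst ℝ C(simplexSphere n, ℝ) X) (fun _ _ => rfl) (graphGen x) hg
    exact ⟨⟨p, Submodule.le_topologicalClosure _ hp⟩, hpg⟩
  obtain ⟨T, hT⟩ := Submodule.exists_eq_graph (G := Γ) ⟨hanti.injective, hsurj⟩
  have hmem : ∀ p, p ∈ Γ ↔ p.2 = T p.1 := fun p => by rw [hT, LinearMap.mem_graph_iff]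
  refine ⟨T.comp (restr n), fun j => ?_, fun h₁ h₂ => ?_⟩
  · have : graphGen x j ∈ Γ := Submodule.le_topologicalClosure _ (gen_mem_latSpan _ j)
    exact ((hmem _).1 this).symm
  · have := hsup (restr n h₁, T (restr n h₁)) ((hmem _).2 rfl) (restr n h₂, T (restr n h₂))
      ((hmem _).2 rfl)
    exact ((hmem _).1 this).symm

theorem abs_le_of_norm_restr_le (h : HomogFun n) {ε : ℝ} (hε : ‖restr n h‖ ≤ ε) :
    |h| ≤ ε • ∑ j, |proj n j| := by
  have key : ∀ t, |h.1 t| ≤ ε * ∑ j, |t j| := by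
    intro t
    have hr0 : 0 ≤ ∑ j, |t j| := Finset.sum_nonneg fun j _ => abs_nonneg _
    set r := ∑ j, |t j| with hr
    rcases hr0.eq_or_lt with h0 | hpos
    · have ht : t = (0 : ℝ) • t := by
        funext j
        have := (Finset.sum_eq_zero_iff_of_nonneg fun j _ => abs_nonneg _).1 (hr ▸ h0).symm j
          (Finset.mem_univ j)
        simpa using this
      rw [ht, h.2 0 le_rfl, ← h0]
      simp
    · have hS : r⁻¹ • t ∈ simplexSphere n := by
        change ∑ j, |r⁻¹ * t j| = 1
        simp only [abs_mul, ← Finset.mul_sum, abs_of_pos (inv_pos.2 hpos), ← hr]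
        exact inv_mul_cancel₀ hpos.ne'
      have h1 : |h.1 (r⁻¹ • t)| ≤ ε := ((restr n h).norm_coe_le_norm ⟨_, hS⟩).trans hε
      rw [h.2 _ (inv_nonneg.2 hr0), abs_mul, abs_of_pos (inv_pos.2 hpos)] at h1
      rwa [inv_mul_le_iff₀ hpos, mul_comm] at h1
  have hsum : ∀ t, (∑ j, |proj n j|).1 t = ∑ j, |t j| := by
    intro t
    rw [Submodule.coe_sum, ContinuousMap.sum_apply]
    rfl
  refine sup_le (fun t => ?_) (fun t => ?_)
  · change h.1 t ≤ ε * (∑ j, |proj n j|).1 t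
    rw [hsum]
    exact (le_abs_self _).trans (key t)
  · change -h.1 t ≤ ε * (∑ j, |proj n j|).1 t
    rw [hsum]
    exact (neg_le_abs _).trans (key t)

theorem IsKrivine.norm_le {x : Fin n → X} {τ : HomogFun n →ₗ[ℝ] X} (hτ : IsKrivine x τ)
    (h : HomogFun n) : ‖τ h‖ ≤ ‖restr n h‖ * ‖∑ j, |x j|‖ := by
  have hmono : ∀ f g : HomogFun n, f ≤ g → τ f ≤ τ g := fun f g hfg => by
    have := hτ.2 f g
    rw [sup_eq_right.2 hfg] at this
    rw [this]
    exact le_sup_left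
  have hsum : τ (∑ j, |proj n j|) = ∑ j, |x j| := by
    rw [map_sum]
    refine Finset.sum_congr rfl fun j _ => ?_
    rw [abs, hτ.2, map_neg, hτ.1]
    rfl
  have habs := abs_le_of_norm_restr_le h le_rfl
  have h1 := hmono _ _ ((le_abs_self h).trans habs)
  have h2 := hmono _ _ ((neg_le_abs h).trans habs)
  rw [map_smul, hsum] at h1 h2
  rw [map_neg] at h2
  have h3 : |τ h| ≤ |(‖restr n h‖ • ∑ j, |x j| : X)| := (sup_le h1 h2).trans (le_abs_self _)
  have h4 := norm_le_norm_of_abs_le_abs h3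
  rwa [norm_smul, norm_norm] at h4

theorem IsKrivine.unique {x : Fin n → X} {τ σ : HomogFun n →ₗ[ℝ] X} (hτ : IsKrivine x τ)
    (hσ : IsKrivine x σ) : τ = σ := by
  refine LinearMap.ext fun h => ?_
  by_contra hne
  have hD : 0 < ‖τ h - σ h‖ := norm_pos_iff.2 (sub_ne_zero.2 hne)
  set e := ‖∑ j, |x j|‖ with he
  have he0 : 0 ≤ e := norm_nonneg _
  obtain ⟨f, hf, hfd⟩ := Metric.mem_closure_iff.1 (mem_closure_latSpan_restr (restr n h))
    (‖τ h - σ h‖ / (2 * e + 1)) (by positivity)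
  obtain ⟨g, hg, rfl⟩ := exists_map_eq_of_mem_latSpan (restr n) restr_sup (proj n) hf
  rw [dist_eq_norm, ← map_sub] at hfd
  have h1 := hτ.norm_le (h - g)
  have h2 := hσ.norm_le (h - g)
  have h3 : τ g = σ g := eq_on_latSpan τ σ hτ.2 hσ.2 (proj n)
    (fun j => (hτ.1 j).trans (hσ.1 j).symm) hg
  have h4 : ‖τ h - σ h‖ ≤ ‖τ (h - g)‖ + ‖σ (h - g)‖ := by
    rw [show τ h - σ h = τ (h - g) - σ (h - g) by rw [map_sub, map_sub, h3]; abel]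
    exact norm_sub_le _ _
  rw [lt_div_iff₀ (by positivity)] at hfd
  have h5 := norm_nonneg (restr n (h - g))
  nlinarith

/-- Krivine's functional calculus `τ : HomogFun n → X` at `x = (x₁, …, xₙ)`: the unique linear map
that sends the `j`-th projection to `xⱼ` and preserves suprema. -/
noncomputable def krivine [CompleteSpace X] (x : Fin n → X) : HomogFun n →ₗ[ℝ] X :=
  (exists_isKrivine x).choose

theorem krivine_spec [CompleteSpace X] (x : Fin n → X) : IsKrivine x (krivine x) :=
  (exists_isKrivine x).choose_spec

end Krivine

/-! ### Convex operators -/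

section Convex

variable {E X : Type*} [NormedAddCommGroup E] [NormedSpace ℝ E]
  [NormedAddCommGroup X] [Lattice X] [HasSolidNorm X] [IsOrderedAddMonoid X] [NormedSpace ℝ X]
  [IsOrderedModule ℝ X] [CompleteSpace X]

/-- The element `‖(x₁, …, xₙ)‖_Y` of `X` -/
noncomputable def latticeNorm (Y : BanachSeqLattice) {n : ℕ} (x : Fin n → X) : X :=
  krivine x (Y.homogNorm n)

/-- `T` is `Y`-convex:
`‖ ‖(T w₁, …, T wₙ)‖_Y ‖_X ≤ C ‖(‖w₁‖, …, ‖wₙ‖)‖_Y` for some constant `C > 0`. -/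
def IsYConvex (Y : BanachSeqLattice) (T : E →ₗ[ℝ] X) : Prop :=
  ∃ C : ℝ, 0 < C ∧ ∀ (n : ℕ) (w : Fin n → E),
    ‖latticeNorm Y (fun j => T (w j))‖ ≤ C * Y.finNorm n (fun j => ‖w j‖)

/-- The set `𝒦^Y(E, X)` of all `Y`-convex operators -/
def convexOperators (Y : BanachSeqLattice) (E X : Type*) [NormedAddCommGroup E] [NormedSpace ℝ E]
    [NormedAddCommGroup X] [Lattice X] [HasSolidNorm X] [IsOrderedAddMonoid X] [NormedSpace ℝ X]
    [IsOrderedModule ℝ X] [CompleteSpace X] : Set (E →ₗ[ℝ] X) :=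
  {T | IsYConvex Y T}

end Convex

/-! A finite rank operator is majorized: writing `T w` in a basis `b i` of its range, with
continuous coordinates `f i`, gives `T w ≤ ‖w‖ • u` for `u = ∑ i, ‖f i‖ • |b i|`. Applied to `-w` as
well, this says that `|T w| ≤ ‖w‖ • u`.

Majorization implies `Y`-convexity because the norm of `Y` on `ℝⁿ` is a supremum of linear
functionals `a` (Hahn–Banach). Krivine's calculus turns a finite supremum of such functionals into
the supremum of the vectors `∑ aⱼ T wⱼ = T (∑ aⱼ wⱼ)`, each at most `(∑ |aⱼ| ‖wⱼ‖) • u`. The norm of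
`Y` is solid, so `|a|` also lies below it, and that coefficient is at most `N = ‖(‖w₁‖, …,
‖wₙ‖)‖_Y`. The whole supremum is thus at most `N • u`.

Finite suprema suffice: by compactness of the sphere they approximate the norm of `Y` uniformly
(`exists_supLin_approx`), and `IsKrivine.norm_le` carries the error to `X`. -/

namespace BanachSeqLattice

/-! ### Linear functionals below the norm of `Y` -/

theorem finNorm_le_of_abs_le (Y : BanachSeqLattice) {n : ℕ} {s t : Fin n → ℝ}
    (h : ∀ j, |s j| ≤ |t j|) : Y.finNorm n s ≤ Y.finNorm n t := by
  refine Y.norm_le_of_abs_le _ _ fun k => ?_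
  change |extendZero n s k| ≤ |extendZero n t k|
  by_cases hk : k < n
  · simpa [extendZero, hk] using h ⟨k, hk⟩
  · simp [extendZero, hk]

/-- Evaluating the functional at `|t|` with its coordinates multiplied by the signs of `a` produces
the left side, and solidity says that this change of signs does not increase the norm. -/
theorem sum_abs_mul_le_finNorm (Y : BanachSeqLattice) {n : ℕ} {a : Fin n → ℝ}
    (ha : ∀ t, ∑ j, a j * t j ≤ Y.finNorm n t) (t : Fin n → ℝ) :
    ∑ j, |a j| * |t j| ≤ Y.finNorm n t := by
  have h : ∀ c : ℝ, ∃ s : ℝ, |s| ≤ 1 ∧ |c| = c * s := fun c => by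
    rcases le_total 0 c with hc | hc
    · exact ⟨1, by simp, by rw [abs_of_nonneg hc, mul_one]⟩
    · exact ⟨-1, by simp, by rw [abs_of_nonpos hc, mul_neg_one]⟩
  choose s hs hs' using h
  calc ∑ j, |a j| * |t j| = ∑ j, a j * (s (a j) * |t j|) :=
        Finset.sum_congr rfl fun j _ => by rw [hs', mul_assoc]
    _ ≤ Y.finNorm n (fun j => s (a j) * |t j|) := ha _
    _ ≤ Y.finNorm n t := Y.finNorm_le_of_abs_le fun j => by
        rw [abs_mul, abs_abs]
        exact mul_le_of_le_one_left (abs_nonneg _) (hs _)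

end BanachSeqLattice

/-- A seminorm on `ℝⁿ` is attained at every point by a linear functional below it. -/
theorem Seminorm.exists_dual_pi {n : ℕ} (p : Seminorm ℝ (Fin n → ℝ)) (t : Fin n → ℝ) :
    ∃ a : Fin n → ℝ, (∀ s, ∑ j, a j * s j ≤ p s) ∧ ∑ j, a j * t j = p t := by
  obtain ⟨g, hg, hgp⟩ : ∃ g : (Fin n → ℝ) →ₗ[ℝ] ℝ, g t = p t ∧ ∀ s, g s ≤ p s := by
    -- The line through `t` carries the functional `c • t ↦ c * p t` only when `t ≠ 0`; at the
    -- origin the zero functional serves.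
    by_cases ht : t = 0
    · exact ⟨0, by simp [ht], fun s => by simp⟩
    -- Hahn–Banach extends `c • t ↦ c * p t`, which is below `p` on the line since `c ≤ |c|`.
    obtain ⟨g, hg, hgp⟩ := exists_extension_of_le_sublinear
      (LinearPMap.mkSpanSingleton t (p t) ht) p
      (fun c hc x => by rw [map_smul_eq_mul, Real.norm_of_nonneg hc.le]) (map_add_le_add p) (by
        rintro ⟨x, hx⟩
        obtain ⟨c, rfl⟩ := Submodule.mem_span_singleton.1 hx
        rw [LinearPMap.mkSpanSingleton'_apply, map_smul_eq_mul, smul_eq_mul]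
        exact mul_le_mul_of_nonneg_right (le_abs_self c) (apply_nonneg p t))
    refine ⟨g, ?_, hgp⟩
    have := hg ⟨t, Submodule.mem_span_singleton_self t⟩
    rw [this, LinearPMap.mkSpanSingleton_apply]
  have hsum : ∀ s, ∑ j, g (Pi.single j 1) * s j = g s := fun s => by
    conv_rhs => rw [show s = ∑ j, s j • (Pi.single j 1 : Fin n → ℝ) by
      simpa using pi_eq_sum_univ' s]
    simp [mul_comm]
  exact ⟨fun j => g (Pi.single j 1), fun s => (hsum s).trans_le (hgp s), (hsum t).trans hg⟩

/-- Evaluation at `t` is linear, preserves suprema and sends the projections to the coordinates of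
`t`. -/
theorem supLin_proj_apply {n : ℕ} (A : Finset (Fin n → ℝ)) (hA : A.Nonempty) (t : Fin n → ℝ) :
    (supLin (proj n) A hA).1 t = supLin t A hA :=
  map_supLin ((ContinuousMap.evalCLM ℝ t).toLinearMap.comp (HomogFun n).subtype)
    (fun _ _ => rfl) (proj n) A hA

/-- The norm of `Y` on `ℝⁿ` is a uniform limit on the sphere of finite suprema of linear
functionals below it. -/
theorem BanachSeqLattice.exists_supLin_approx (Y : BanachSeqLattice) (n : ℕ) {ε : ℝ}
    (hε : 0 < ε) :
    ∃ A : Finset (Fin n → ℝ), ∃ hA : A.Nonempty, 0 ∈ A ∧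
      (∀ a ∈ A, ∀ t, ∑ j, a j * t j ≤ Y.finNorm n t) ∧
      ‖restr n (Y.homogNorm n - supLin (proj n) A hA)‖ ≤ ε := by
  classical
  choose a ha hat using (Y.finNorm n).exists_dual_pi
  have hN := Y.continuous_finNorm n
  -- The functional `a t` attains the norm at `t`, so it stays within `ε` of it on a neighbourhood
  -- of `t`; finitely many neighbourhoods cover the sphere.
  obtain ⟨F, hF⟩ := (isCompact_univ (X := simplexSphere n)).elim_finite_subcover
    (fun t : simplexSphere n =>
      {s : simplexSphere n | Y.finNorm n s.1 - ε < ∑ j, a t.1 j * s.1 j})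
    (fun t => isOpen_lt ((hN.comp continuous_subtype_val).sub continuous_const)
      (continuous_finsetSum _ fun j _ => continuous_const.mul
        ((continuous_apply j).comp continuous_subtype_val)))
    (fun t _ => Set.mem_iUnion.2 ⟨t, by
      change _ < ∑ j, a t.1 j * t.1 j
      rw [hat]
      linarith⟩)
  -- Adding the zero functional makes the family nonempty even when `n = 0`, where the sphere is
  -- empty, and makes its supremum nonnegative.
  have h0 : (0 : Fin n → ℝ) ∈ insert 0 (F.image fun t => a t.1) := Finset.mem_insert_self _ _
  have hA : ∀ b ∈ insert 0 (F.image fun t => a t.1), ∀ t, ∑ j, b j * t j ≤ Y.finNorm n t := by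
    intro b hb t
    rcases Finset.mem_insert.1 hb with rfl | hb
    · simp
    · obtain ⟨r, _, rfl⟩ := Finset.mem_image.1 hb
      exact ha _ t
  refine ⟨_, Finset.insert_nonempty _ _, h0, hA, ?_⟩
  rw [ContinuousMap.norm_le _ hε.le]
  intro s
  change |Y.finNorm n s.1 - (supLin (proj n) _ _).1 s.1| ≤ ε
  rw [supLin_proj_apply, abs_le]
  have hlin : ∀ c : Fin n → ℝ, Fintype.linearCombination ℝ s.1 c = ∑ j, c j * s.1 j := fun c => by
    simp [Fintype.linearCombination_apply]
  constructor
  · have : supLin s.1 (insert 0 (F.image fun t => a t.1)) (Finset.insert_nonempty _ _) ≤ Y.finNorm n s.1 :=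
      Finset.sup'_le _ _ fun b hb => (hlin b).trans_le (hA b hb s.1)
    linarith
  · obtain ⟨t, ht, hst⟩ := Set.mem_iUnion₂.1 (hF (Set.mem_univ s))
    have h1 : Y.finNorm n s.1 - ε < ∑ j, a t.1 j * s.1 j := hst
    have h2 : ∑ j, a t.1 j * s.1 j ≤
        supLin s.1 (insert 0 (F.image fun t => a t.1)) (Finset.insert_nonempty _ _) := by
      rw [← hlin]
      exact Finset.le_sup' (Fintype.linearCombination ℝ s.1)
        (Finset.mem_insert_of_mem (Finset.mem_image_of_mem (fun t => a t.1) ht))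
    linarith

/-! ### Operators majorized by a positive element -/

theorem smul_le_abs_smul_abs {V : Type*} [Lattice V] [AddCommGroup V] [IsOrderedAddMonoid V]
    [Module ℝ V] [IsOrderedModule ℝ V] (c : ℝ) (x : V) : c • x ≤ |c| • |x| := by
  rcases le_total 0 c with hc | hc
  · rw [abs_of_nonneg hc]
    exact smul_le_smul_of_nonneg_left (le_abs_self x) hc
  · rw [abs_of_nonpos hc, ← neg_smul_neg c x]
    exact smul_le_smul_of_nonneg_left (neg_le_abs x) (neg_nonneg.2 hc)

section Majorized

variable {E X : Type*} [NormedAddCommGroup E] [NormedSpace ℝ E]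
  [NormedAddCommGroup X] [Lattice X] [IsOrderedAddMonoid X] [NormedSpace ℝ X]
  [IsOrderedModule ℝ X]

/-- An operator that maps the unit ball into an order interval is `Y`-convex. -/
theorem isYConvex_of_le_norm_smul [HasSolidNorm X] [CompleteSpace X] (Y : BanachSeqLattice)
    (T : E →ₗ[ℝ] X) (u : X) (hu : 0 ≤ u) (hT : ∀ w, T w ≤ ‖w‖ • u) : IsYConvex Y T := by
  -- The estimate holds with `‖u‖`; the added `1` only keeps the constant positive when `u = 0`.
  refine ⟨‖u‖ + 1, by positivity, fun n w => ?_⟩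
  set N := Y.finNorm n (fun j => ‖w j‖)
  have hN : 0 ≤ N := apply_nonneg _ _
  suffices h : ‖latticeNorm Y (fun j => T (w j))‖ ≤ N * ‖u‖ by nlinarith
  set τ := krivine (fun j => T (w j))
  have hτ : IsKrivine _ τ := krivine_spec (fun j => T (w j))
  set e := ‖∑ j, |T (w j)|‖
  have key : ∀ ε : ℝ, 0 < ε → ‖τ (Y.homogNorm n)‖ ≤ N * ‖u‖ + ε * e := by
    intro ε hε
    obtain ⟨A, hne, h0, hA, hε'⟩ := Y.exists_supLin_approx n hε
    have h1 : τ (supLin (proj n) A hne) = supLin (fun j => T (w j)) A hne := by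
      rw [map_supLin τ hτ.2]
      congr 1
      exact funext hτ.1
    have h2 : supLin (fun j => T (w j)) A hne ≤ N • u := by
      refine Finset.sup'_le _ _ fun a ha => ?_
      have hTa : Fintype.linearCombination ℝ (fun j => T (w j)) a = T (∑ j, a j • w j) := by
        simp [Fintype.linearCombination_apply]
      rw [hTa]
      refine (hT _).trans (smul_le_smul_of_nonneg_right ?_ hu)
      refine (norm_sum_le _ _).trans ?_
      simpa [norm_smul] using Y.sum_abs_mul_le_finNorm (hA a ha) (fun j => ‖w j‖)
    -- Nonnegativity, from `0 ∈ A`, is what lets the upper bound `h2` control the absolute value and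
    -- hence the norm.
    have h3 : 0 ≤ supLin (fun j => T (w j)) A hne := by
      rw [← map_zero (Fintype.linearCombination ℝ (fun j => T (w j)))]
      exact Finset.le_sup' (Fintype.linearCombination ℝ (fun j => T (w j))) h0
    have h4 : ‖supLin (fun j => T (w j)) A hne‖ ≤ N * ‖u‖ := by
      rw [← abs_of_nonneg hN, ← Real.norm_eq_abs, ← norm_smul]
      refine norm_le_norm_of_abs_le_abs ?_
      rw [abs_of_nonneg h3, abs_of_nonneg (smul_nonneg hN hu)]
      exact h2
    -- The cost of replacing the norm of `Y` by the finite supremum is at most `ε * e`.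
    have h5 := hτ.norm_le (Y.homogNorm n - supLin (proj n) A hne)
    rw [map_sub, h1] at h5
    have h6 := norm_add_le (τ (Y.homogNorm n) - supLin (fun j => T (w j)) A hne)
      (supLin (fun j => T (w j)) A hne)
    rw [sub_add_cancel] at h6
    have h7 := mul_le_mul_of_nonneg_right hε' (norm_nonneg (∑ j, |T (w j)|))
    linarith
  refine le_of_forall_pos_le_add fun δ hδ => ?_
  have he : 0 ≤ e := norm_nonneg _
  -- Dividing by `e + 1` rather than `e` allows `e = 0`.
  refine (key (δ / (e + 1)) (by positivity)).trans (add_le_add le_rfl ?_)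
  rw [div_mul_eq_mul_div, div_le_iff₀ (by positivity)]
  nlinarith

/-- A finite rank operator maps the unit ball into an order interval. -/
theorem exists_le_norm_smul_of_finiteDimensional_range (T : E →L[ℝ] X)
    (hT : FiniteDimensional ℝ (LinearMap.range (T : E →ₗ[ℝ] X))) :
    ∃ u : X, 0 ≤ u ∧ ∀ w, T w ≤ ‖w‖ • u := by
  set R := LinearMap.range (T : E →ₗ[ℝ] X)
  let b := Module.finBasis ℝ R
  let T' : E →L[ℝ] R := T.codRestrict R fun w => ⟨w, rfl⟩
  -- The coordinate functionals are continuous because `R` is finite-dimensional, so their operator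
  -- norms are available.
  let f : Fin (Module.finrank ℝ R) → E →L[ℝ] ℝ := fun i =>
    (LinearMap.toContinuousLinearMap (b.coord i)).comp T'
  refine ⟨∑ i, ‖f i‖ • |(b i : X)|,
    Finset.sum_nonneg fun i _ => smul_nonneg (norm_nonneg _) (abs_nonneg _), fun w => ?_⟩
  have hw : T w = ∑ i, f i w • (b i : X) := by
    have := congrArg (Subtype.val : R → X) (b.sum_repr (T' w))
    rw [Submodule.coe_sum] at this
    exact this.symm
  rw [hw, Finset.smul_sum]
  refine Finset.sum_le_sum fun i _ => (smul_le_abs_smul_abs _ _).trans ?_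
  rw [smul_smul, mul_comm]
  exact smul_le_smul_of_nonneg_right ((f i).le_opNorm w) (abs_nonneg _)

end Majorized

/-! ### The proposition -/

theorem mainTheorem4 {E X : Type*}
    [NormedAddCommGroup E] [NormedSpace ℝ E] [CompleteSpace E]
    [NormedAddCommGroup X] [Lattice X] [HasSolidNorm X] [IsOrderedAddMonoid X]
    [NormedSpace ℝ X] [IsOrderedModule ℝ X] [CompleteSpace X]
    (Y : BanachSeqLattice) :
    (∀ T : E →L[ℝ] X, FiniteDimensional ℝ (LinearMap.range (T : E →ₗ[ℝ] X)) →
      (T : E →ₗ[ℝ] X) ∈ convexOperators Y E X) ∧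
    (Nontrivial E → Nontrivial X → ∃ T ∈ convexOperators Y E X, T ≠ 0) := by
  have main : ∀ T : E →L[ℝ] X, FiniteDimensional ℝ (LinearMap.range (T : E →ₗ[ℝ] X)) →
      (T : E →ₗ[ℝ] X) ∈ convexOperators Y E X := fun T hT => by
    obtain ⟨u, hu, h⟩ := exists_le_norm_smul_of_finiteDimensional_range T hT
    exact isYConvex_of_le_norm_smul Y _ u hu h
  refine ⟨main, fun _ _ => ?_⟩
  obtain ⟨w, hw⟩ := exists_ne (0 : E)
  obtain ⟨x, hx⟩ := exists_ne (0 : X)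
  -- A functional `f` with `f w ≠ 0` gives the rank one operator `v ↦ f v • x`, which is nonzero at
  -- `w`.
  obtain ⟨f, hf⟩ := SeparatingDual.exists_ne_zero (R := ℝ) hw
  refine ⟨(f.smulRight x : E →L[ℝ] X), main _ ?_, fun h => ?_⟩
  · refine Submodule.finiteDimensional_of_le (S₂ := Submodule.span ℝ {x}) ?_
    rintro _ ⟨v, rfl⟩
    exact Submodule.smul_mem _ _ (Submodule.mem_span_singleton_self x)
  · have : f w • x = 0 := LinearMap.congr_fun h w
    exact (smul_ne_zero hf hx) this
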